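/- Let $\gamma$ be the Euler–Mascheroni constant and let $${}_pF_q(a_1,\dots,a_p;b_1,\dots,b_q;x)=\sum_{n\ge0}\frac{(a_1)_n\cdots(a_p)_n}{(b_1)_n\cdots(b_q)_n}\frac{x^n}{n!},\qquad (c)_n=c(c+1)\cdots(c+n-1).$$ Let $a_k$ be the coefficient of $x^k$ in the (everywhere convergent) power series of $6\,{}_2F_2(2,2;3,\tfrac72;-x)-4\,{}_1F_1(\tfrac32;\tfrac72;-\tfrac x2)$, that is $$a_k=6\,\frac{(2)_k(2)_k}{(3)_k(7/2)_k\,k!}(-1)^k-4\,\frac{(3/2)_k}{(7/2)_k\,k!}\Bigl(-\frac12\Bigr)^k ,$$ and for $t,\tau>0$ put $$H(t,\tau)=\frac{\tau^3(t\tau^2)^2}{45\pi}\Bigl(6\,{}_2F_2\bigl(2,2;3,\tfrac72;-t\tau^2\bigr)-4\,{}_1F_1\bigl(\tfrac32;\tfrac72;-\tfrac{t\tau^2}2\bigr)\Bigr),\qquad R(t,\tau)=\frac{\tau^3(t\tau^2)^2}{45\pi}\sum_{k=1}^\infty a_k(t\tau^2)^k .$$ 1. For all $t,\tau>0$ the series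 in $R$ converges and $H(t,\tau)=\dfrac{2\tau^7t^2}{45\pi}+R(t,\tau)$. Moreover $R$ consists of terms of order $\tau^9$ and higher: there is an absolute constant $C$ with $|R(t,\tau)|\le C\,t^3\tau^9$ whenever $t,\tau>0$ and $t\tau^2\le1$. 2. There is an absolute constant $C$ such that, for all $t,\tau>0$ with $t\tau^2\ge1$, $$\Bigl|H(t,\tau)-\frac{\tau^3}{\pi}\Bigl(-\frac{\sqrt{2\pi}}3(t\tau^2)^{1/2}+\log(4t\tau^2)+\gamma-3\Bigr)\Bigr|\le C\,\tau^2\,t^{-1/2}.$$ 3. For all $\beta,\tau>0$, as $t\to\infty$, the following two explicit functions, which occur as the $\tau^3$ term of the spectral form factor in universal GOE random matrix theory (left) and as a $t$-dependent $\tau^3$ bracket in its Weil–Petersson volume computation (right), satisfy $$-\tau^3\,\frac{\log(2\beta\tau^2)+\gamma+\frac13}{\pi}=\frac{\tau^3}{\pi}\Bigl(-\frac{10}3+\log\frac{2t}{\beta}-\frac{\sqrt{2\pi}}3(t\tau^2)^{1/2}-\frac{2(t\tau^2)^2}{45}\Bigr)-R(t,\tau)+O(t^{-1/2}),$$ where the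 error is bounded in absolute value by $C\,\tau^2\,t^{-1/2}$, with an absolute constant $C$, for all $\beta,t,\tau>0$ with $t\tau^2\ge1$. -/

import Mathlib

open scoped Nat

noncomputable section

/-- The `n`-th Taylor coefficient `(a₁)ₙ ⋯ (a_p)ₙ / ((b₁)ₙ ⋯ (b_q)ₙ n!)` of the generalized
hypergeometric function `pFq(a; b; ·)`, where `(c)ₙ = c (c + 1) ⋯ (c + n - 1)`. -/
def hypergeometricCoeff (a b : List ℝ) (n : ℕ) : ℝ :=
  (a.map fun c => (ascPochhammer ℝ n).eval c).prod /
    ((b.map fun c => (ascPochhammer ℝ n).eval c).prod * (n ! : ℝ))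

/-- The generalized hypergeometric function `pFq(a; b; x)` of a real variable, with `p = a.length`
and `q = b.length`. It is used below for `p ≤ q` and positive `b`, where its power series converges
for every real `x`. -/
def hypergeometric (a b : List ℝ) (x : ℝ) : ℝ :=
  ∑' n : ℕ, hypergeometricCoeff a b n * x ^ n

/-- `6 · ₂F₂(2, 2; 3, 7/2; -x) - 4 · ₁F₁(3/2; 7/2; -x/2)`. -/
def hypergeometricCombination (x : ℝ) : ℝ :=
  6 * hypergeometric [2, 2] [3, 7 / 2] (-x) - 4 * hypergeometric [3 / 2] [7 / 2] (-x / 2)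

/-- The coefficient `a_k` of `x ^ k` in the power series of `hypergeometricCombination`. -/
def combinationCoeff (k : ℕ) : ℝ :=
  6 * hypergeometricCoeff [2, 2] [3, 7 / 2] k * (-1) ^ k -
    4 * hypergeometricCoeff [3 / 2] [7 / 2] k * (-1 / 2) ^ k

/-- `τ³ (tτ²)² / (45π) · (6 · ₂F₂(2, 2; 3, 7/2; -tτ²) - 4 · ₁F₁(3/2; 7/2; -tτ²/2))`. -/
def hypergeometricTerm (t τ : ℝ) : ℝ :=
  τ ^ 3 * (t * τ ^ 2) ^ 2 / (45 * Real.pi) * hypergeometricCombination (t * τ ^ 2)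

/-- The terms of order `τ⁹` and higher of the power series of `hypergeometricTerm t τ`:
`τ³ (tτ²)² / (45π) · ∑_{k ≥ 1} a_k (tτ²)^k`. -/
def higherOrderTerms (t τ : ℝ) : ℝ :=
  τ ^ 3 * (t * τ ^ 2) ^ 2 / (45 * Real.pi) *
    ∑' k : ℕ, combinationCoeff (k + 1) * (t * τ ^ 2) ^ (k + 1)

/-- `-τ³ (log(2βτ²) + γ + 1/3) / π`, the `τ³` term of the universal GOE spectral form factor. -/
def goeCubicTerm (β τ : ℝ) : ℝ :=
  -τ ^ 3 * ((Real.log (2 * β * τ ^ 2) + Real.eulerMascheroniConstant + 1 / 3) / Real.pi)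

/-- `τ³/π (-10/3 + log(2t/β) - (√(2π)/3) (tτ²)^{1/2} - 2(tτ²)²/45)`, the `t`-dependent `τ³`
bracket of the Weil-Petersson spectral form factor. -/
def wpCubicTerm (β t τ : ℝ) : ℝ :=
  τ ^ 3 / Real.pi *
    (-10 / 3 + Real.log (2 * t / β) - Real.sqrt (2 * Real.pi) / 3 * (t * τ ^ 2) ^ (1 / 2 : ℝ)
      - 2 * (t * τ ^ 2) ^ 2 / 45)

end

/-! Write x = tτ². Beta integrals turn both hypergeometric series into integrals over v ∈ [0, 1]
against v²(1 - v²), and `hypergeometricCombination_eq` expresses x²/45 times the combination as A(x)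
- B(x). Here A integrates 2v²(1 - (1 + xs)e^{-xs})/s with s = 1 - v², and B is (2/3)x² ∫ v²(1 -
v²)e^{-xv²/2}.

B is a truncated Gaussian moment and gives √(2π)/3 · x^{1/2}
(`exists_abs_integral_sub_gaussian_moment_le`). In A, replacing 2v² by 2v allows the substitution s
= 1 - v² and yields Ein(x) - 1 + e^{-x}, where Ein(x) = log x + γ + O(e^{-x}); the correction
contributes 2 log 2 - 2 + O(1/x). Hence A = log(4x) + γ - 3 + O(1/x) (`abs_integral_sub_log_le`).

The small-x claims are absolute convergence of an entire series. The cubic-term comparison is the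
large-x expansion rewritten by an exact identity (`goeCubicTerm_sub_eq`). -/

/-! ### Integral representations of the hypergeometric series -/

/-- Dominated convergence: since |u| ≤ 1 on [0, 1], the k-th term is at most |w| |y|^k / k!. Applied
below with w = v²(1 - v²) and u = v² or 1 - v². -/
lemma hasSum_integral_mul_pow {b : ℕ → ℝ} (hb : ∀ k, |b k| ≤ 1 / (k ! : ℝ)) {F : ℝ → ℝ}
    (hF : ∀ z, HasSum (fun k => b k * z ^ k) (F z)) {w u : ℝ → ℝ} (hw : Continuous w)
    (hu : Continuous u) (hu1 : ∀ v ∈ Set.Icc (0 : ℝ) 1, |u v| ≤ 1) (y : ℝ) :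
    HasSum (fun k => b k * (∫ v in (0 : ℝ)..1, w v * u v ^ k) * y ^ k)
      (∫ v in (0 : ℝ)..1, w v * F (y * u v)) := by
  have hexp : HasSum (fun k : ℕ => |y| ^ k / (k ! : ℝ)) (Real.exp |y|) := by
    rw [Real.exp_eq_exp_ℝ]
    exact NormedSpace.expSeries_div_hasSum_exp (|y|)
  have key := intervalIntegral.hasSum_integral_of_dominated_convergence
    (μ := MeasureTheory.volume) (a := (0 : ℝ)) (b := 1)
    (F := fun k v => w v * (b k * (y * u v) ^ k)) (f := fun v => w v * F (y * u v))
    (fun k v => |w v| * (|y| ^ k / (k ! : ℝ))) ?_ ?_ ?_ ?_ ?_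
  · refine HasSum.congr_fun key fun k => ?_
    rw [mul_assoc, ← intervalIntegral.integral_mul_const,
      ← intervalIntegral.integral_const_mul]
    congr 1
    ext v
    rw [mul_pow]
    ring
  · intro k
    exact (by fun_prop : Continuous fun v => w v * (b k * (y * u v) ^ k)).aestronglyMeasurable
  · refine fun k => Filter.Eventually.of_forall fun v hv => ?_
    rw [Set.uIoc_of_le zero_le_one] at hv
    have h1 := hu1 v ⟨hv.1.le, hv.2⟩
    rw [Real.norm_eq_abs, abs_mul, abs_mul, abs_pow, abs_mul]
    have h2 : (|y| * |u v|) ^ k ≤ |y| ^ k :=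
      pow_le_pow_left₀ (by positivity) (mul_le_of_le_one_right (abs_nonneg y) h1) k
    have h3 : |b k| * (|y| * |u v|) ^ k ≤ 1 / (k ! : ℝ) * |y| ^ k :=
      mul_le_mul (hb k) h2 (by positivity) (by positivity)
    refine mul_le_mul_of_nonneg_left (h3.trans_eq (by ring)) (abs_nonneg _)
  · exact Filter.Eventually.of_forall fun v _ => hexp.summable.mul_left _
  · have : (fun v => ∑' k : ℕ, |w v| * (|y| ^ k / (k ! : ℝ))) =
        fun v => |w v| * Real.exp |y| := by
      ext v
      rw [tsum_mul_left, hexp.tsum_eq]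
    rw [this]
    exact (by fun_prop : Continuous fun v => |w v| * Real.exp |y|).intervalIntegrable _ _
  · exact Filter.Eventually.of_forall fun v _ => (hF _).mul_left _

/-- At c = 3/2 this makes (3/2)_k / (7/2)_k the rational function of k given by the beta integral
below. -/
lemma ascPochhammer_eval_add_two (c : ℝ) (k : ℕ) :
    (ascPochhammer ℝ k).eval c * ((c + k) * (c + k + 1)) =
      c * (c + 1) * (ascPochhammer ℝ k).eval (c + 2) := by
  induction k with
  | zero => simp
  | succ k ih =>
    rw [ascPochhammer_succ_eval, ascPochhammer_succ_eval]
    push_cast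
    linear_combination (c + 2 + k) * ih

lemma integral_sq_mul_one_sub_sq_mul_pow (k : ℕ) :
    ∫ v in (0 : ℝ)..1, v ^ 2 * (1 - v ^ 2) * (v ^ 2) ^ k =
      2 / ((2 * (k : ℝ) + 3) * (2 * k + 5)) := by
  have h : (fun v : ℝ => v ^ 2 * (1 - v ^ 2) * (v ^ 2) ^ k) =
      fun v => v ^ (2 * k + 2) - v ^ (2 * k + 4) := by
    ext v
    ring
  rw [h, intervalIntegral.integral_sub (by simp) (by simp), integral_pow,
    integral_pow]
  push_cast
  simp
  field_simp
  ring

lemma hypergeometricCoeff_one_one (k : ℕ) :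
    hypergeometricCoeff [3 / 2] [7 / 2] k =
      15 / 2 * (1 / (k ! : ℝ) * ∫ v in (0 : ℝ)..1, v ^ 2 * (1 - v ^ 2) * (v ^ 2) ^ k) := by
  have h := ascPochhammer_eval_add_two (3 / 2) k
  have hp : 0 < (ascPochhammer ℝ k).eval (7 / 2 : ℝ) := ascPochhammer_pos k _ (by norm_num)
  norm_num at h
  rw [integral_sq_mul_one_sub_sq_mul_pow]
  simp only [hypergeometricCoeff, List.map_cons, List.map_nil, List.prod_cons, List.prod_nil,
    mul_one]
  field_simp
  linear_combination 4 * h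

lemma hasSum_exp_pow (z : ℝ) : HasSum (fun k : ℕ => 1 / (k ! : ℝ) * z ^ k) (Real.exp z) := by
  rw [Real.exp_eq_exp_ℝ]
  exact (NormedSpace.expSeries_div_hasSum_exp z).congr_fun fun k => by ring

lemma hasSum_hypergeometric_one_one (y : ℝ) :
    HasSum (fun k => hypergeometricCoeff [3 / 2] [7 / 2] k * y ^ k)
      (15 / 2 * ∫ v in (0 : ℝ)..1, v ^ 2 * (1 - v ^ 2) * Real.exp (y * v ^ 2)) := by
  have key := hasSum_integral_mul_pow (b := fun k => 1 / (k ! : ℝ))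
    (fun k => (abs_of_nonneg (by positivity)).le) hasSum_exp_pow
    (w := fun v => v ^ 2 * (1 - v ^ 2)) (u := fun v => v ^ 2) (by fun_prop) (by fun_prop)
    (fun v hv => by rw [abs_of_nonneg (by positivity)]; exact pow_le_one₀ hv.1 hv.2) y
  refine HasSum.congr_fun (key.mul_left (15 / 2)) fun k => ?_
  rw [hypergeometricCoeff_one_one]
  ring

lemma integral_sq_mul_one_sub_sq_pow_succ (k : ℕ) :
    (2 * (k : ℝ) + 5) * ∫ v in (0 : ℝ)..1, v ^ 2 * (1 - v ^ 2) ^ (k + 1) =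
      2 * ((k : ℝ) + 1) * ∫ v in (0 : ℝ)..1, v ^ 2 * (1 - v ^ 2) ^ k := by
  -- The primitive v³(1 - v²)^{k+1} vanishes at both endpoints, so integrating its derivative gives
  -- the recurrence.
  have hd : ∀ v ∈ Set.uIcc (0 : ℝ) 1, HasDerivAt (fun v : ℝ => v ^ 3 * (1 - v ^ 2) ^ (k + 1))
      ((2 * k + 5) * (v ^ 2 * (1 - v ^ 2) ^ (k + 1)) -
        2 * (k + 1) * (v ^ 2 * (1 - v ^ 2) ^ k)) v := by
    intro v _
    refine ((hasDerivAt_pow 3 v).mul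
      (((hasDerivAt_pow 2 v).const_sub 1).pow (k + 1))).congr_deriv ?_
    push_cast
    simp
    ring
  have hi : ∀ (c : ℝ) (m : ℕ), IntervalIntegrable (fun v : ℝ => c * (v ^ 2 * (1 - v ^ 2) ^ m))
      MeasureTheory.volume 0 1 := fun c m =>
    (by fun_prop : Continuous fun v : ℝ => c * (v ^ 2 * (1 - v ^ 2) ^ m)).intervalIntegrable _ _
  have h := intervalIntegral.integral_eq_sub_of_hasDerivAt hd ((hi _ _).sub (hi _ _))
  rw [intervalIntegral.integral_sub (hi _ _) (hi _ _), intervalIntegral.integral_const_mul,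
    intervalIntegral.integral_const_mul] at h
  simp at h
  linarith

lemma ascPochhammer_mul_integral (k : ℕ) :
    (ascPochhammer ℝ k).eval (7 / 2 : ℝ) *
      (∫ v in (0 : ℝ)..1, v ^ 2 * (1 - v ^ 2) * (1 - v ^ 2) ^ k) =
        2 / 15 * (ascPochhammer ℝ k).eval (2 : ℝ) := by
  induction k with
  | zero =>
    have h := integral_sq_mul_one_sub_sq_mul_pow 0
    simp at h
    simp [h]
    norm_num
  | succ k ih =>
    have h := integral_sq_mul_one_sub_sq_pow_succ (k + 1)
    have e : ∀ m : ℕ, (fun v : ℝ => v ^ 2 * (1 - v ^ 2) * (1 - v ^ 2) ^ m) =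
        fun v => v ^ 2 * (1 - v ^ 2) ^ (m + 1) := fun m => by ext v; ring
    rw [e] at ih ⊢
    rw [ascPochhammer_succ_eval, ascPochhammer_succ_eval]
    push_cast at h
    linear_combination (k + 2 : ℝ) * ih + (ascPochhammer ℝ k).eval (7 / 2 : ℝ) / 2 * h

/-- One quotient (2)_k / (7/2)_k is a beta integral; the other, (2)_k / (3)_k, telescopes to 2/(k +
2). -/
lemma hypergeometricCoeff_two_two (k : ℕ) :
    hypergeometricCoeff [2, 2] [3, 7 / 2] k =
      15 * (1 / ((k + 2) * (k ! : ℝ)) *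
        ∫ v in (0 : ℝ)..1, v ^ 2 * (1 - v ^ 2) * (1 - v ^ 2) ^ k) := by
  have h := ascPochhammer_mul_integral k
  have hp : 0 < (ascPochhammer ℝ k).eval (7 / 2 : ℝ) := ascPochhammer_pos k _ (by norm_num)
  have hp3 : 0 < (ascPochhammer ℝ k).eval (3 : ℝ) := ascPochhammer_pos k _ (by norm_num)
  have h3 : (ascPochhammer ℝ k).eval (2 : ℝ) * (k + 2) = 2 * (ascPochhammer ℝ k).eval (3 : ℝ) := by
    clear h hp hp3
    induction k with
    | zero => simp
    | succ k ih =>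
      rw [ascPochhammer_succ_eval, ascPochhammer_succ_eval]
      push_cast
      linear_combination (3 + k : ℝ) * ih
  simp only [hypergeometricCoeff, List.map_cons, List.map_nil, List.prod_cons, List.prod_nil,
    mul_one]
  set J := ∫ v in (0 : ℝ)..1, v ^ 2 * (1 - v ^ 2) * (1 - v ^ 2) ^ k
  have hJ : J = 2 / 15 * (ascPochhammer ℝ k).eval (2 : ℝ) / (ascPochhammer ℝ k).eval (7 / 2) := by
    rw [eq_div_iff hp.ne', ← h]; ring
  rw [hJ]
  field_simp
  linear_combination (ascPochhammer ℝ k).eval (2 : ℝ) * h3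

/-- The entire function `z ↦ (1 - (1 - z) eᶻ) / z²`. -/
noncomputable def expMoment (z : ℝ) : ℝ := ∑' k : ℕ, 1 / ((k + 2) * (k ! : ℝ)) * z ^ k

lemma inv_add_two_mul_factorial_le (k : ℕ) :
    |1 / ((k + 2) * (k ! : ℝ))| ≤ 1 / (k ! : ℝ) := by
  rw [abs_of_nonneg (by positivity)]
  refine one_div_le_one_div_of_le (by positivity) ?_
  have : (0 : ℝ) < (k ! : ℝ) := by positivity
  nlinarith [(k.cast_nonneg : (0 : ℝ) ≤ k)]

lemma hasSum_expMoment (z : ℝ) :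
    HasSum (fun k : ℕ => 1 / ((k + 2) * (k ! : ℝ)) * z ^ k) (expMoment z) := by
  refine Summable.hasSum (Summable.of_norm_bounded (hasSum_exp_pow |z|).summable fun k => ?_)
  rw [Real.norm_eq_abs, abs_mul, abs_pow]
  exact mul_le_mul_of_nonneg_right (inv_add_two_mul_factorial_le k) (by positivity)

/-- Termwise, 1/((k + 2) k!) = 1/(k + 1)! - 1/(k + 2)!, a difference of two shifted exponential
series. -/
lemma sq_mul_expMoment (z : ℝ) : z ^ 2 * expMoment z = 1 - (1 - z) * Real.exp z := by
  have h0 := (hasSum_nat_add_iff' 2).2 (hasSum_exp_pow z)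
  have h1 := ((hasSum_nat_add_iff' 1).2 (hasSum_exp_pow z)).mul_left z
  have h2 := (hasSum_expMoment z).mul_left (z ^ 2)
  have h3 := h1.sub h0
  have e : (fun k : ℕ => z ^ 2 * (1 / ((k + 2) * (k ! : ℝ)) * z ^ k)) =
      fun k => z * (1 / ((k + 1)! : ℝ) * z ^ (k + 1)) - 1 / ((k + 2)! : ℝ) * z ^ (k + 2) := by
    ext k
    rw [Nat.factorial_succ (k + 1), Nat.factorial_succ k]
    push_cast
    field_simp
    ring
  rw [e] at h2
  rw [h2.unique h3]
  simp [Finset.sum_range_succ]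
  ring

lemma hasSum_hypergeometric_two_two (y : ℝ) :
    HasSum (fun k => hypergeometricCoeff [2, 2] [3, 7 / 2] k * y ^ k)
      (15 * ∫ v in (0 : ℝ)..1, v ^ 2 * (1 - v ^ 2) * expMoment (y * (1 - v ^ 2))) := by
  have key := hasSum_integral_mul_pow inv_add_two_mul_factorial_le hasSum_expMoment
    (w := fun v => v ^ 2 * (1 - v ^ 2)) (u := fun v => 1 - v ^ 2) (by fun_prop) (by fun_prop)
    (fun v hv => by
      rw [abs_of_nonneg (sub_nonneg.2 (pow_le_one₀ hv.1 hv.2))]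
      linarith [sq_nonneg v]) y
  refine HasSum.congr_fun (key.mul_left 15) fun k => ?_
  rw [hypergeometricCoeff_two_two]
  ring

lemma hasSum_combinationCoeff (x : ℝ) :
    HasSum (fun k => combinationCoeff k * x ^ k) (hypergeometricCombination x) := by
  have h2 := hasSum_hypergeometric_two_two (-x)
  have h1 := hasSum_hypergeometric_one_one (-x / 2)
  rw [hypergeometricCombination, hypergeometric, hypergeometric, h1.tsum_eq, h2.tsum_eq]
  refine HasSum.congr_fun ((h2.mul_left 6).sub (h1.mul_left 4)) fun k => ?_
  rw [combinationCoeff, neg_pow x, show -x / 2 = -1 / 2 * x by ring, mul_pow]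
  ring

lemma combinationCoeff_zero : combinationCoeff 0 = 2 := by
  simp [combinationCoeff, hypergeometricCoeff]
  norm_num

/-! ### The entire exponential integral and Euler's constant -/

/-- The entire exponential integral `∫₀ˣ (1 - e⁻ᵘ) / u du`. -/
noncomputable def entireExpIntegral (x : ℝ) : ℝ :=
  ∫ u in (0 : ℝ)..x, (1 - Real.exp (-u)) / u

lemma abs_one_sub_exp_neg_div_le {u : ℝ} (hu : 0 ≤ u) : |(1 - Real.exp (-u)) / u| ≤ 1 := by
  have h1 : Real.exp (-u) ≤ 1 := Real.exp_le_one_iff.2 (by linarith)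
  have h2 := Real.one_sub_le_exp_neg u
  rw [abs_of_nonneg (div_nonneg (by linarith) hu)]
  exact div_le_one_of_le₀ (by linarith) hu

lemma intervalIntegrable_of_abs_le {f : ℝ → ℝ} (hf : Measurable f) {a b M : ℝ} (hab : a ≤ b)
    (h : ∀ u ∈ Set.Ioc a b, |f u| ≤ M) : IntervalIntegrable f MeasureTheory.volume a b := by
  rw [intervalIntegrable_iff_integrableOn_Ioc_of_le hab]
  refine MeasureTheory.Measure.integrableOn_of_bounded (M := M) (by simp)
    hf.aestronglyMeasurable ?_
  filter_upwards [MeasureTheory.ae_restrict_mem measurableSet_Ioc] with u hu using h u hu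

lemma intervalIntegrable_one_sub_exp_neg_div {a b : ℝ} (ha : 0 ≤ a) (hab : a ≤ b) :
    IntervalIntegrable (fun u : ℝ => (1 - Real.exp (-u)) / u) MeasureTheory.volume a b :=
  intervalIntegrable_of_abs_le (by fun_prop) hab fun _ hu =>
    abs_one_sub_exp_neg_div_le (ha.trans hu.1.le)

lemma integral_exp_neg_mul {c : ℝ} (hc : c ≠ 0) (a b : ℝ) :
    ∫ s in a..b, Real.exp (-(c * s)) = (Real.exp (-(c * a)) - Real.exp (-(c * b))) / c := by
  rw [intervalIntegral.integral_eq_sub_of_hasDerivAt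
    (f := fun s => -Real.exp (-(c * s)) / c)]
  · ring
  · intro s _
    refine (((hasDerivAt_id s).const_mul c).neg.exp.neg.div_const c).congr_deriv ?_
    simp
    field_simp
  · exact (by fun_prop : Continuous fun s => Real.exp (-(c * s))).intervalIntegrable _ _

/-- The difference of the two values is ∫ e^{-u}/u over [x, y], which lies between 0 and e^{-x}
because u ≥ 1. -/
lemma entireExpIntegral_sub_log_bounds {x y : ℝ} (hx : 1 ≤ x) (hxy : x ≤ y) :
    entireExpIntegral y - Real.log y ≤ entireExpIntegral x - Real.log x ∧
      entireExpIntegral x - Real.log x ≤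
        entireExpIntegral y - Real.log y + Real.exp (-x) := by
  have hx0 : 0 < x := by linarith
  have hy0 : 0 < y := by linarith
  have hne : ∀ u ∈ Set.uIcc x y, u ≠ 0 := fun u hu => by
    rw [Set.uIcc_of_le hxy] at hu
    linarith [hu.1]
  have hsplit : entireExpIntegral y = entireExpIntegral x +
      ∫ u in x..y, (1 - Real.exp (-u)) / u :=
    (intervalIntegral.integral_add_adjacent_intervals
      (intervalIntegrable_one_sub_exp_neg_div le_rfl hx0.le)
      (intervalIntegrable_one_sub_exp_neg_div hx0.le hxy)).symm
  have i1 : IntervalIntegrable (fun u : ℝ => 1 / u) MeasureTheory.volume x y :=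
    ContinuousOn.intervalIntegrable (continuousOn_const.div continuousOn_id hne)
  have i2 : IntervalIntegrable (fun u : ℝ => Real.exp (-u) / u) MeasureTheory.volume x y :=
    ContinuousOn.intervalIntegrable ((by fun_prop : Continuous fun u : ℝ =>
      Real.exp (-u)).continuousOn.div continuousOn_id hne)
  have h : ∫ u in x..y, (1 - Real.exp (-u)) / u =
      Real.log y - Real.log x - ∫ u in x..y, Real.exp (-u) / u := by
    simp_rw [sub_div]
    rw [intervalIntegral.integral_sub i1 i2, integral_one_div_of_pos hx0 hy0,
      Real.log_div hy0.ne' hx0.ne']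
  have hnonneg : 0 ≤ ∫ u in x..y, Real.exp (-u) / u :=
    intervalIntegral.integral_nonneg hxy fun u hu => by
      have : 0 < u := by linarith [hu.1]
      positivity
  have hle : ∫ u in x..y, Real.exp (-u) / u ≤ Real.exp (-x) := by
    have := intervalIntegral.integral_mono_on hxy i2
      ((by fun_prop : Continuous fun u : ℝ => Real.exp (-(1 * u))).intervalIntegrable _ _)
      fun u hu => by
        rw [one_mul]
        exact div_le_self (Real.exp_pos _).le (by linarith [hu.1])
    rw [integral_exp_neg_mul one_ne_zero] at this
    simp only [one_mul, div_one] at this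
    linarith [Real.exp_pos (-y)]
  constructor <;> linarith

lemma integral_one_sub_exp_neg_mul_div {x : ℝ} (hx : 0 < x) :
    ∫ s in (0 : ℝ)..1, (1 - Real.exp (-(x * s))) / s = entireExpIntegral x := by
  have h := intervalIntegral.integral_comp_mul_left (a := 0) (b := 1)
    (fun u : ℝ => (1 - Real.exp (-u)) / u) hx.ne'
  simp only [mul_zero, mul_one, smul_eq_mul] at h
  rw [entireExpIntegral, ← mul_right_inj' (inv_ne_zero hx.ne'), ← h,
    ← intervalIntegral.integral_const_mul]
  congr 1
  ext s
  field_simp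

/-- The integrand is the geometric sum of (1 - s)^j for j < n. Comparing (1 - s)^n with e^{-ns} then
links Ein(n) to the harmonic numbers, hence to γ. -/
lemma integral_one_sub_one_sub_pow_div (n : ℕ) :
    ∫ s in (0 : ℝ)..1, (1 - (1 - s) ^ n) / s = harmonic n := by
  have h : ∫ s in (0 : ℝ)..1, (1 - (1 - s) ^ n) / s =
      ∫ s in (0 : ℝ)..1, ∑ j ∈ Finset.range n, (1 - s) ^ j := by
    refine intervalIntegral.integral_congr_ae (Filter.Eventually.of_forall fun s hs => ?_)
    rw [Set.uIoc_of_le zero_le_one] at hs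
    rw [div_eq_iff hs.1.ne']
    linear_combination geom_sum_mul (1 - s) n
  rw [h, intervalIntegral.integral_finsetSum fun j _ => 
    (by fun_prop : Continuous fun s : ℝ => (1 - s) ^ j).intervalIntegrable _ _]
  simp only [harmonic, Rat.cast_sum]
  refine Finset.sum_congr rfl fun j _ => ?_
  rw [intervalIntegral.integral_comp_sub_left (fun s : ℝ => s ^ j), integral_pow]
  simp

lemma one_sub_pow_le_exp {s : ℝ} (hs : s ≤ 1) (n : ℕ) :
    (1 - s) ^ n ≤ Real.exp (-(n * s)) := by
  rw [show -(n * s) = n * (-s) by ring, Real.exp_nat_mul]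
  exact pow_le_pow_left₀ (by linarith) (Real.one_sub_le_exp_neg s) n

/-- Bernoulli's inequality for (1 - s²)^n, combined with (1 + s)^n ≤ e^{ns}. -/
lemma exp_sub_one_sub_pow_le {s : ℝ} (h0 : 0 ≤ s) (hs : s ≤ 1) (n : ℕ) :
    Real.exp (-(n * s)) - (1 - s) ^ n ≤ n * s ^ 2 * Real.exp (-(n * s)) := by
  have h1 : (1 + s) ^ n ≤ Real.exp (n * s) := by
    rw [Real.exp_nat_mul]
    exact pow_le_pow_left₀ (by linarith) (by linarith [Real.add_one_le_exp s]) n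
  have h2 : 1 - n * s ^ 2 ≤ ((1 - s) * (1 + s)) ^ n := by
    have := one_add_mul_le_pow (a := -s ^ 2) (by nlinarith) n
    rw [show (1 - s) * (1 + s) = 1 + -s ^ 2 by ring]
    linarith
  have h3 : 1 - n * s ^ 2 ≤ (1 - s) ^ n * Real.exp (n * s) := by
    refine h2.trans ?_
    rw [mul_pow]
    exact mul_le_mul_of_nonneg_left h1 (pow_nonneg (by linarith) n)
  have h4 := mul_le_mul_of_nonneg_right h3 (Real.exp_pos (-(n * s))).le
  rw [mul_assoc, ← Real.exp_add, add_neg_cancel, Real.exp_zero] at h4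
  linarith

lemma integral_mul_exp_neg_mul_le {c : ℝ} (hc : 0 < c) :
    ∫ s in (0 : ℝ)..1, c * s * Real.exp (-(c * s)) ≤ 1 / c := by
  rw [intervalIntegral.integral_eq_sub_of_hasDerivAt
    (f := fun s => -(1 + c * s) * Real.exp (-(c * s)) / c)]
  · have : 0 ≤ (1 + c * 1) * Real.exp (-(c * 1)) / c := by positivity
    simp only [mul_zero, neg_zero, Real.exp_zero] at this ⊢
    have e : -(1 + c * 1) * Real.exp (-(c * 1)) / c - -(1 + 0) * 1 / c =
      1 / c - (1 + c * 1) * Real.exp (-(c * 1)) / c := by ring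
    linarith
  · intro s _
    refine (((((hasDerivAt_id s).const_mul c).const_add 1).neg.mul
      ((hasDerivAt_id s).const_mul c).neg.exp).div_const c).congr_deriv ?_
    simp
    field_simp
    ring
  · exact (by fun_prop : Continuous fun s => c * s * Real.exp (-(c * s))).intervalIntegrable _ _

lemma abs_entireExpIntegral_sub_harmonic_le {n : ℕ} (hn : 0 < n) :
    |entireExpIntegral n - harmonic n| ≤ 1 / n := by
  have hn' : (0 : ℝ) < n := by exact_mod_cast hn
  have hm : Measurable fun s : ℝ => (1 - Real.exp (-(n * s))) / s := by fun_prop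
  have i1 : IntervalIntegrable (fun s : ℝ => (1 - Real.exp (-(n * s))) / s)
      MeasureTheory.volume 0 1 := by
    refine intervalIntegrable_of_abs_le (M := n) hm zero_le_one fun s hs => ?_
    have h1 : Real.exp (-(n * s)) ≤ 1 := Real.exp_le_one_iff.2 (by nlinarith [hs.1])
    have h2 := Real.one_sub_le_exp_neg (n * s)
    rw [abs_of_nonneg (div_nonneg (by linarith) hs.1.le), div_le_iff₀ hs.1]
    linarith
  have i2 : IntervalIntegrable (fun s : ℝ => (1 - (1 - s) ^ n) / s)
      MeasureTheory.volume 0 1 := by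
    refine intervalIntegrable_of_abs_le (M := n) (by fun_prop) zero_le_one fun s hs => ?_
    have h1 : (1 - s) ^ n ≤ 1 := pow_le_one₀ (by linarith [hs.2]) (by linarith [hs.1])
    have h2 := one_add_mul_le_pow (a := -s) (by linarith [hs.2]) n
    rw [← sub_eq_add_neg 1 s] at h2
    rw [abs_of_nonneg (div_nonneg (by linarith) hs.1.le), div_le_iff₀ hs.1]
    linarith
  rw [← integral_one_sub_exp_neg_mul_div hn', ← integral_one_sub_one_sub_pow_div,
    ← intervalIntegral.integral_sub i1 i2, ← Real.norm_eq_abs]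
  refine (intervalIntegral.norm_integral_le_integral_norm zero_le_one).trans
    (le_trans ?_ (integral_mul_exp_neg_mul_le hn'))
  refine intervalIntegral.integral_mono_on zero_le_one (i1.sub i2).norm
    ((by fun_prop : Continuous fun s : ℝ =>
      n * s * Real.exp (-(n * s))).intervalIntegrable _ _) fun s hs => ?_
  rw [← sub_div, Real.norm_eq_abs, abs_div, abs_of_nonneg hs.1]
  refine div_le_of_le_mul₀ hs.1 (by have := hs.1; positivity) ?_
  rw [abs_le]
  have h1 := one_sub_pow_le_exp hs.2 n
  have h2 := exp_sub_one_sub_pow_le hs.1 hs.2 n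
  have h3 : 0 ≤ n * s ^ 2 * Real.exp (-(n * s)) := by positivity
  constructor <;> linarith

lemma tendsto_entireExpIntegral_sub_log :
    Filter.Tendsto (fun n : ℕ => entireExpIntegral n - Real.log n) Filter.atTop
      (nhds Real.eulerMascheroniConstant) := by
  have h : Filter.Tendsto (fun n : ℕ => entireExpIntegral n - harmonic n) Filter.atTop
      (nhds 0) := by
    refine squeeze_zero_norm' ?_ tendsto_one_div_atTop_nhds_zero_nat
    filter_upwards [Filter.eventually_gt_atTop 0] with n hn
    exact abs_entireExpIntegral_sub_harmonic_le hn
  simpa using h.add Real.tendsto_harmonic_sub_log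

lemma abs_entireExpIntegral_sub_log_sub_le {x : ℝ} (hx : 1 ≤ x) :
    |entireExpIntegral x - Real.log x - Real.eulerMascheroniConstant| ≤ Real.exp (-x) := by
  have hev : ∀ᶠ n : ℕ in Filter.atTop, x ≤ n :=
    tendsto_natCast_atTop_atTop.eventually_ge_atTop x
  -- Let y tend to infinity through the integers in the two-sided bounds.
  have h1 := le_of_tendsto tendsto_entireExpIntegral_sub_log
    (hev.mono fun n hn => (entireExpIntegral_sub_log_bounds hx hn).1)
  have h2 := ge_of_tendsto (tendsto_entireExpIntegral_sub_log.add_const (Real.exp (-x)))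
    (hev.mono fun n hn => (entireExpIntegral_sub_log_bounds hx hn).2)
  rw [abs_le]
  constructor <;> linarith [Real.exp_pos (-x)]

/-! ### The truncated Gaussian moment -/

open MeasureTheory Set in
-- Compare with ∫ v² e^{-bv²} over (0, ∞). The integrands differ by v⁴e^{-bv²} on (0, 1] and by
-- v²e^{-bv²} ≤ v⁴e^{-bv²} beyond, so the error is at most the full fourth moment, Γ(5/2)/2 ·
-- b^{-5/2}.
lemma exists_abs_integral_sub_gaussian_moment_le :
    ∃ C : ℝ, ∀ b : ℝ, 0 < b →
      |(∫ v in (0 : ℝ)..1, v ^ 2 * (1 - v ^ 2) * Real.exp (-b * v ^ 2)) -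
        Real.sqrt Real.pi / 4 * b ^ (-3 / 2 : ℝ)| ≤ C * b ^ (-5 / 2 : ℝ) := by
  refine ⟨1 / 2 * Real.Gamma (5 / 2), fun b hb => ?_⟩
  have m2 := integral_rpow_mul_exp_neg_mul_rpow (p := 2) (q := 2) two_pos (by norm_num) hb
  have m4 := integral_rpow_mul_exp_neg_mul_rpow (p := 2) (q := 4) two_pos (by norm_num) hb
  have j2 := integrableOn_rpow_mul_exp_neg_mul_rpow (p := 2) (s := 2) (by norm_num) two_pos hb
  have j4 := integrableOn_rpow_mul_exp_neg_mul_rpow (p := 2) (s := 4) (by norm_num) two_pos hb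
  have hG : Real.Gamma (3 / 2) = Real.sqrt Real.pi / 2 := by
    rw [show (3 / 2 : ℝ) = 1 / 2 + 1 by norm_num, Real.Gamma_add_one (by norm_num),
      Real.Gamma_one_half_eq]
    ring
  simp only [Real.rpow_ofNat] at m2 m4 j2 j4
  norm_num at m2 m4
  rw [hG] at m2
  have hsplit : ∫ v in (0 : ℝ)..1, v ^ 2 * (1 - v ^ 2) * Real.exp (-b * v ^ 2) =
      ∫ v in Ioi (0 : ℝ), (Ioc (0 : ℝ) 1).indicator
        (fun v => v ^ 2 * (1 - v ^ 2) * Real.exp (-b * v ^ 2)) v := by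
    rw [intervalIntegral.integral_of_le zero_le_one, setIntegral_indicator measurableSet_Ioc,
      inter_eq_right.2 fun v hv => hv.1]
  have jI : IntegrableOn (fun v => (Ioc (0 : ℝ) 1).indicator
      (fun v => v ^ 2 * (1 - v ^ 2) * Real.exp (-b * v ^ 2)) v) (Ioi 0) := by
    refine Integrable.integrableOn ((integrable_indicator_iff measurableSet_Ioc).2 ?_)
    exact (by fun_prop : Continuous fun v : ℝ =>
      v ^ 2 * (1 - v ^ 2) * Real.exp (-b * v ^ 2)).integrableOn_Ioc
  have hle := setIntegral_mono_on (j2.sub jI) j4 measurableSet_Ioi fun v hv => by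
    have hE := Real.exp_pos (-b * v ^ 2)
    have hv0 : (0 : ℝ) < v := hv
    by_cases h1 : v ≤ 1
    · have hmem : v ∈ Ioc (0 : ℝ) 1 := ⟨hv0, h1⟩
      rw [Pi.sub_apply, indicator_of_mem hmem]
      exact le_of_eq (by ring)
    · rw [Pi.sub_apply, indicator_of_notMem (fun h => h1 h.2), sub_zero]
      exact mul_le_mul_of_nonneg_right
        (pow_le_pow_right₀ (not_le.1 h1).le (by norm_num)) hE.le
  have hge := setIntegral_mono_on jI j2 measurableSet_Ioi fun v hv => by
    have hE := Real.exp_pos (-b * v ^ 2)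
    have hv0 : (0 : ℝ) < v := hv
    by_cases h1 : v ≤ 1
    · have hmem : v ∈ Ioc (0 : ℝ) 1 := ⟨hv0, h1⟩
      rw [indicator_of_mem hmem]
      refine mul_le_mul_of_nonneg_right ?_ hE.le
      nlinarith [sq_nonneg (v ^ 2)]
    · rw [indicator_of_notMem (fun h => h1 h.2)]
      positivity
  simp only [Pi.sub_apply] at hle
  rw [integral_sub j2 jI] at hle
  rw [← hsplit] at hle hge
  simp only [neg_mul] at *
  rw [m2] at hle hge
  rw [m4] at hle
  norm_num at *
  rw [abs_le]
  constructor <;> linarith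

/-! ### The logarithmic integral -/

lemma one_add_mul_exp_neg_bounds {z : ℝ} (hz : 0 ≤ z) :
    1 - z ≤ (1 + z) * Real.exp (-z) ∧ (1 + z) * Real.exp (-z) ≤ 1 := by
  have h1 := Real.one_sub_le_exp_neg z
  have h2 := mul_le_mul_of_nonneg_right (Real.add_one_le_exp z) (Real.exp_pos (-z)).le
  rw [← Real.exp_add, add_neg_cancel, Real.exp_zero] at h2
  constructor
  · nlinarith [mul_nonneg hz (Real.exp_pos (-z)).le]
  · linarith

lemma abs_one_sub_mul_exp_neg_div_le {x s : ℝ} (hx : 0 ≤ x) (hs : 0 ≤ s) :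
    |(1 - (1 + x * s) * Real.exp (-(x * s))) / s| ≤ x := by
  have h := one_add_mul_exp_neg_bounds (mul_nonneg hx hs)
  rw [abs_of_nonneg (div_nonneg (by linarith) hs)]
  exact div_le_of_le_mul₀ hs hx (by linarith)

lemma integral_one_sub_mul_exp_neg_div {x : ℝ} (hx : 0 < x) :
    ∫ s in (0 : ℝ)..1, (1 - (1 + x * s) * Real.exp (-(x * s))) / s =
      entireExpIntegral x - 1 + Real.exp (-x) := by
  have i1 : IntervalIntegrable (fun s : ℝ => (1 - Real.exp (-(x * s))) / s)
      MeasureTheory.volume 0 1 := by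
    refine intervalIntegrable_of_abs_le (M := x) (by fun_prop) zero_le_one fun s hs => ?_
    have h := mul_le_mul_of_nonneg_left (abs_one_sub_exp_neg_div_le (mul_nonneg hx.le hs.1.le))
      hx.le
    have e : (1 - Real.exp (-(x * s))) / s = x * ((1 - Real.exp (-(x * s))) / (x * s)) := by
      have := hs.1.ne'
      field_simp
    rw [e, abs_mul, abs_of_pos hx]
    linarith
  have i2 : IntervalIntegrable (fun s : ℝ => x * Real.exp (-(x * s)))
      MeasureTheory.volume 0 1 :=
    (by fun_prop : Continuous fun s : ℝ => x * Real.exp (-(x * s))).intervalIntegrable _ _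
  have h : ∫ s in (0 : ℝ)..1, (1 - (1 + x * s) * Real.exp (-(x * s))) / s =
      ∫ s in (0 : ℝ)..1, ((1 - Real.exp (-(x * s))) / s - x * Real.exp (-(x * s))) := by
    refine intervalIntegral.integral_congr_ae (Filter.Eventually.of_forall fun s hs => ?_)
    rw [Set.uIoc_of_le zero_le_one] at hs
    have := hs.1.ne'
    field_simp
    ring
  rw [h, intervalIntegral.integral_sub i1 i2, integral_one_sub_exp_neg_mul_div hx,
    intervalIntegral.integral_const_mul, integral_exp_neg_mul hx.ne']
  field_simp
  simp
  ring

/-- Substitution s = 1 - v². Continuity is required only for s > 0 because the intended g is a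
quotient by s; the bound M supplies integrability. -/
lemma integral_comp_one_sub_sq {g : ℝ → ℝ} {M : ℝ} (hg : Measurable g)
    (hc : ContinuousOn g (Set.Ioi 0)) (hM : ∀ s, 0 ≤ s → |g s| ≤ M) :
    ∫ v in (0 : ℝ)..1, 2 * v * g (1 - v ^ 2) = ∫ s in (0 : ℝ)..1, g s := by
  have hI : MeasureTheory.IntegrableOn g (Set.Icc 0 1) :=
    MeasureTheory.Measure.integrableOn_of_bounded (M := M) (by simp) hg.aestronglyMeasurable
      ((MeasureTheory.ae_restrict_iff' measurableSet_Icc).2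
        (Filter.Eventually.of_forall fun s hs => hM s hs.1))
  have key := intervalIntegral.integral_comp_mul_deriv''' (a := 0) (b := 1)
    (f := fun v : ℝ => 1 - v ^ 2) (f' := fun v => -(2 * v)) (g := g) (by fun_prop) ?_ ?_ ?_ ?_
  · simp only [Function.comp, mul_neg, intervalIntegral.integral_neg] at key
    norm_num at key
    rw [intervalIntegral.integral_symm 0 1, neg_inj] at key
    rw [← key]
    congr 1
    ext v
    ring
  · intro v _
    exact (((hasDerivAt_pow 2 v).const_sub 1).congr_deriv (by simp)).hasDerivWithinAt
  · refine hc.mono ?_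
    rintro _ ⟨v, hv, rfl⟩
    norm_num at hv
    have : v ^ 2 < 1 := by nlinarith
    simpa using this
  · refine hI.mono_set ?_
    rintro _ ⟨v, hv, rfl⟩
    rw [Set.uIcc_of_le zero_le_one] at hv
    exact ⟨sub_nonneg.2 (pow_le_one₀ hv.1 hv.2), sub_le_self _ (sq_nonneg v)⟩
  · rw [Set.uIcc_of_le zero_le_one]
    refine MeasureTheory.Measure.integrableOn_of_bounded (M := M * 2) (by simp)
      (by fun_prop : Measurable _).aestronglyMeasurable
      ((MeasureTheory.ae_restrict_iff' measurableSet_Icc).2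
        (Filter.Eventually.of_forall fun v hv => ?_))
    rw [Real.norm_eq_abs, abs_mul, abs_neg, abs_of_nonneg (by linarith [hv.1] : 0 ≤ 2 * v)]
    have hg1 := hM (1 - v ^ 2) (by nlinarith [hv.1, hv.2])
    exact mul_le_mul hg1 (by linarith [hv.2]) (by linarith [hv.1]) ((abs_nonneg _).trans hg1)

lemma integral_two_mul_div_one_add :
    ∫ v in (0 : ℝ)..1, 2 * v / (1 + v) = 2 - 2 * Real.log 2 := by
  have hne : ∀ v ∈ Set.uIcc (0 : ℝ) 1, 1 + v ≠ 0 := fun v hv => by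
    rw [Set.uIcc_of_le zero_le_one] at hv
    linarith [hv.1]
  rw [intervalIntegral.integral_eq_sub_of_hasDerivAt
    (f := fun v => 2 * v - 2 * Real.log (1 + v))]
  · norm_num
  · intro v hv
    refine (((hasDerivAt_id v).const_mul 2).sub
      ((((hasDerivAt_id v).const_add 1).log (hne v hv)).const_mul 2)).congr_deriv ?_
    have := hne v hv
    simp
    field_simp
    ring
  · exact ContinuousOn.intervalIntegrable
      ((by fun_prop : ContinuousOn (fun v : ℝ => 2 * v) _).div (by fun_prop) hne)

lemma integral_two_mul_exp_neg_one_sub_sq_le {x : ℝ} (hx : 0 < x) :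
    ∫ v in (0 : ℝ)..1, 2 * v * ((1 + x * (1 - v ^ 2)) * Real.exp (-(x * (1 - v ^ 2)))) ≤
      2 / x := by
  rw [intervalIntegral.integral_eq_sub_of_hasDerivAt
    (f := fun v => (2 + x * (1 - v ^ 2)) * Real.exp (-(x * (1 - v ^ 2))) / x)]
  · have : 0 ≤ (2 + x * (1 - 0 ^ 2)) * Real.exp (-(x * (1 - 0 ^ 2))) / x := by
      norm_num
      positivity
    simpa using this
  · intro v _
    have h := ((hasDerivAt_pow 2 v).const_sub 1).const_mul x
    refine (((h.const_add 2).mul h.neg.exp).div_const x).congr_deriv ?_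
    simp
    field_simp
    ring
  · exact (by fun_prop : Continuous fun v : ℝ => 2 * v *
      ((1 + x * (1 - v ^ 2)) * Real.exp (-(x * (1 - v ^ 2))))).intervalIntegrable _ _

lemma abs_integral_sub_log_le {x : ℝ} (hx : 1 ≤ x) :
    |(∫ v in (0 : ℝ)..1, 2 * v ^ 2 *
        ((1 - (1 + x * (1 - v ^ 2)) * Real.exp (-(x * (1 - v ^ 2)))) / (1 - v ^ 2))) -
      (Real.log (4 * x) + Real.eulerMascheroniConstant - 3)| ≤ 4 / x := by
  have hx0 : 0 < x := by linarith
  set g : ℝ → ℝ := fun s => (1 - (1 + x * s) * Real.exp (-(x * s))) / s with hg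
  set p : ℝ → ℝ := fun s => (1 + x * s) * Real.exp (-(x * s)) with hp
  have hgm : Measurable g := by fun_prop
  have hgM : ∀ s, 0 ≤ s → |g s| ≤ x := fun s hs => abs_one_sub_mul_exp_neg_div_le hx0.le hs
  have hsq : ∀ v ∈ Set.Icc (0 : ℝ) 1, 0 ≤ 1 - v ^ 2 := fun v hv => by
    nlinarith [hv.1, hv.2]
  have hne : ∀ v ∈ Set.uIcc (0 : ℝ) 1, 1 + v ≠ 0 := fun v hv => by
    rw [Set.uIcc_of_le zero_le_one] at hv
    linarith [hv.1]
  have hpc : Continuous p := by fun_prop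
  have i1 : IntervalIntegrable (fun v => 2 * v * g (1 - v ^ 2)) MeasureTheory.volume 0 1 := by
    refine intervalIntegrable_of_abs_le (M := 2 * x) (by fun_prop) zero_le_one fun v hv => ?_
    rw [abs_mul, abs_of_nonneg (by linarith [hv.1] : 0 ≤ 2 * v)]
    exact mul_le_mul (by linarith [hv.2]) (hgM _ (hsq v ⟨hv.1.le, hv.2⟩)) (abs_nonneg _)
      (by norm_num)
  have i2 : IntervalIntegrable (fun v : ℝ => 2 * v / (1 + v)) MeasureTheory.volume 0 1 :=
    ContinuousOn.intervalIntegrable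
      ((by fun_prop : ContinuousOn (fun v : ℝ => 2 * v) _).div (by fun_prop) hne)
  have i3 : IntervalIntegrable (fun v : ℝ => 2 * v / (1 + v) * p (1 - v ^ 2))
      MeasureTheory.volume 0 1 :=
    i2.mul_continuousOn (by fun_prop)
  -- Uses 2v² = 2v - 2v(1 - v) and (1 - v)/(1 - v²) = 1/(1 + v).
  have hsplit : ∫ v in (0 : ℝ)..1, 2 * v ^ 2 * g (1 - v ^ 2) =
      ∫ v in (0 : ℝ)..1, (2 * v * g (1 - v ^ 2) -
        (2 * v / (1 + v) - 2 * v / (1 + v) * p (1 - v ^ 2))) := by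
    refine intervalIntegral.integral_congr fun v hv => ?_
    have h1 := hne v hv
    rw [Set.uIcc_of_le zero_le_one] at hv
    -- At v = 1, division by zero gives g 0 = 0, while p 0 = 1; both sides vanish.
    rcases hv.2.eq_or_lt with rfl | hlt
    · simp [hg, hp]
    · have h2 : 1 - v ^ 2 ≠ 0 := by nlinarith [hv.1]
      have h3 : (1 - p (1 - v ^ 2)) = (1 - v ^ 2) * g (1 - v ^ 2) := by
        simp only [hg, hp]
        field_simp
      have h4 : p (1 - v ^ 2) = 1 - (1 - v ^ 2) * g (1 - v ^ 2) := by linarith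
      simp only [h4]
      field_simp
      ring
  have hlow : 0 ≤ ∫ v in (0 : ℝ)..1, 2 * v / (1 + v) * p (1 - v ^ 2) :=
    intervalIntegral.integral_nonneg zero_le_one fun v hv => by
      have h1 := hv.1
      have h2 := hsq v hv
      positivity
  have hupp : ∫ v in (0 : ℝ)..1, 2 * v / (1 + v) * p (1 - v ^ 2) ≤ 2 / x := by
    refine le_trans (intervalIntegral.integral_mono_on zero_le_one i3
      ((by fun_prop : Continuous fun v : ℝ => 2 * v * p (1 - v ^ 2)).intervalIntegrable _ _)
      fun v hv => ?_) (integral_two_mul_exp_neg_one_sub_sq_le hx0)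
    have h1 := hv.1
    have h2 := hsq v hv
    refine mul_le_mul_of_nonneg_right (div_le_self (by positivity) (by linarith)) (by positivity)
  have hsub := integral_comp_one_sub_sq hgm ?_ hgM
  · rw [integral_one_sub_mul_exp_neg_div hx0] at hsub
    change |(∫ v in (0 : ℝ)..1, 2 * v ^ 2 * g (1 - v ^ 2)) - _| ≤ _
    rw [hsplit, intervalIntegral.integral_sub i1 (i2.sub i3),
      intervalIntegral.integral_sub i2 i3, hsub, integral_two_mul_div_one_add,
      show (4 : ℝ) * x = 2 ^ 2 * x by ring, Real.log_mul (by norm_num) hx0.ne', Real.log_pow]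
    -- The error 4/x collects two terms e^{-x} ≤ 1/x and the 2/x from `hupp`.
    have hE := abs_le.1 (abs_entireExpIntegral_sub_log_sub_le hx)
    have hexp : Real.exp (-x) ≤ 1 / x := by
      rw [Real.exp_neg, ← one_div]
      exact one_div_le_one_div_of_le hx0 (by linarith [Real.add_one_le_exp x])
    have e2 : 2 / x = 2 * (1 / x) := by ring
    have e4 : 4 / x = 4 * (1 / x) := by ring
    have hpos := Real.exp_pos (-x)
    rw [e2] at hupp
    rw [e4, abs_le]
    push_cast
    constructor <;> linarith [hE.1, hE.2]
  · exact ContinuousOn.div (by fun_prop) continuousOn_id fun s hs => (Set.mem_Ioi.1 hs).ne'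

/-! ### Large-argument expansion and the cubic terms -/

lemma hypergeometricCombination_eq (x : ℝ) :
    x ^ 2 / 45 * hypergeometricCombination x =
      (∫ v in (0 : ℝ)..1, 2 * v ^ 2 *
        ((1 - (1 + x * (1 - v ^ 2)) * Real.exp (-(x * (1 - v ^ 2)))) / (1 - v ^ 2))) -
      2 / 3 * x ^ 2 *
        ∫ v in (0 : ℝ)..1, v ^ 2 * (1 - v ^ 2) * Real.exp (-(x / 2) * v ^ 2) := by
  have h : (∫ v in (0 : ℝ)..1, 2 * v ^ 2 *
        ((1 - (1 + x * (1 - v ^ 2)) * Real.exp (-(x * (1 - v ^ 2)))) / (1 - v ^ 2))) =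
      2 * x ^ 2 * ∫ v in (0 : ℝ)..1, v ^ 2 * (1 - v ^ 2) * expMoment (-x * (1 - v ^ 2)) := by
    rw [← intervalIntegral.integral_const_mul]
    congr 1
    ext v
    have hm := sq_mul_expMoment (-x * (1 - v ^ 2))
    rw [show 1 - (1 + x * (1 - v ^ 2)) * Real.exp (-(x * (1 - v ^ 2))) =
      (-x * (1 - v ^ 2)) ^ 2 * expMoment (-x * (1 - v ^ 2)) by rw [hm, neg_mul]; ring]
    by_cases h0 : 1 - v ^ 2 = 0
    · simp [h0]
    · field_simp
  rw [h, hypergeometricCombination, hypergeometric, hypergeometric,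
    (hasSum_hypergeometric_one_one _).tsum_eq, (hasSum_hypergeometric_two_two _).tsum_eq]
  simp only [neg_div]
  ring

lemma exists_abs_hypergeometricCombination_sub_le :
    ∃ C : ℝ, ∀ x : ℝ, 1 ≤ x →
      |x ^ 2 / 45 * hypergeometricCombination x -
        (-(Real.sqrt (2 * Real.pi) / 3) * x ^ (1 / 2 : ℝ) + Real.log (4 * x) +
          Real.eulerMascheroniConstant - 3)| ≤ C * x ^ (-(1 / 2) : ℝ) := by
  obtain ⟨C, hC⟩ := exists_abs_integral_sub_gaussian_moment_le
  -- The 4 absorbs 4/x ≤ 4x^{-1/2}, valid for x ≥ 1; the rest is the Gaussian error (2/3)x² ·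
  -- C(x/2)^{-5/2}.
  refine ⟨4 + 2 / 3 * C / 2 ^ (-5 / 2 : ℝ), fun x hx => ?_⟩
  have hx0 : 0 < x := by linarith
  have hlog := abs_integral_sub_log_le hx
  have hgauss := hC (x / 2) (by positivity)
  rw [hypergeometricCombination_eq]
  set I := ∫ v in (0 : ℝ)..1, 2 * v ^ 2 *
        ((1 - (1 + x * (1 - v ^ 2)) * Real.exp (-(x * (1 - v ^ 2)))) / (1 - v ^ 2))
  set J := ∫ v in (0 : ℝ)..1, v ^ 2 * (1 - v ^ 2) * Real.exp (-(x / 2) * v ^ 2)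
  have h4 : 4 / x ≤ 4 * x ^ (-(1 / 2) : ℝ) := by
    rw [div_eq_mul_inv, ← Real.rpow_neg_one]
    exact mul_le_mul_of_nonneg_left (Real.rpow_le_rpow_of_exponent_le hx (by norm_num))
      (by norm_num)
  have hpow : ∀ a : ℝ, x ^ 2 * (x / 2) ^ a = x ^ (2 + a) / 2 ^ a := fun a => by
    rw [Real.div_rpow hx0.le (by norm_num), Real.rpow_add hx0, Real.rpow_two, mul_div_assoc]
  have hp3 := hpow (-3 / 2)
  have hp5 := hpow (-5 / 2)
  norm_num at hp3 hp5
  have h2 : (2 : ℝ) ^ (-(3 / 2) : ℝ) = (2 * Real.sqrt 2)⁻¹ := by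
    rw [Real.rpow_neg (by norm_num), show (3 / 2 : ℝ) = 1 + 1 / 2 by norm_num,
      Real.rpow_add (by norm_num), Real.rpow_one, Real.sqrt_eq_rpow]
  have hmain : 2 / 3 * x ^ 2 * (Real.sqrt Real.pi / 4 * (x / 2) ^ (-3 / 2 : ℝ)) =
      Real.sqrt (2 * Real.pi) / 3 * x ^ (1 / 2 : ℝ) := by
    norm_num
    rw [h2, div_inv_eq_mul] at hp3
    linear_combination 2 / 3 * (Real.sqrt Real.pi / 4) * hp3
  have herr : 2 / 3 * x ^ 2 * (C * (x / 2) ^ (-5 / 2 : ℝ)) =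
      2 / 3 * C / 2 ^ (-5 / 2 : ℝ) * x ^ (-(1 / 2) : ℝ) := by
    norm_num
    linear_combination 2 / 3 * C * hp5
  have hscaled := mul_le_mul_of_nonneg_left hgauss (by positivity : 0 ≤ 2 / 3 * x ^ 2)
  rw [← abs_of_nonneg (by positivity : 0 ≤ 2 / 3 * x ^ 2), ← abs_mul,
    abs_of_nonneg (by positivity : 0 ≤ 2 / 3 * x ^ 2), mul_sub, hmain, herr] at hscaled
  rw [abs_le] at *
  constructor <;> linarith [hlog.1, hlog.2, hscaled.1, hscaled.2]

lemma cube_mul_rpow_neg_half {t τ : ℝ} (ht : 0 < t) (hτ : 0 < τ) :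
    τ ^ 3 * (t * τ ^ 2) ^ (-(1 / 2) : ℝ) = τ ^ 2 * t ^ (-(1 / 2) : ℝ) := by
  have h : (τ ^ 2) ^ (-(1 / 2) : ℝ) = τ⁻¹ := by
    rw [Real.rpow_neg (by positivity), ← Real.sqrt_eq_rpow, Real.sqrt_sq hτ.le]
  rw [Real.mul_rpow ht.le (by positivity), h]
  field_simp

lemma summable_combinationCoeff_succ (x : ℝ) :
    Summable fun k : ℕ => combinationCoeff (k + 1) * x ^ (k + 1) :=
  (summable_nat_add_iff 1).2 (hasSum_combinationCoeff x).summable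

lemma hypergeometricTerm_eq (t τ : ℝ) :
    hypergeometricTerm t τ = 2 * τ ^ 7 * t ^ 2 / (45 * Real.pi) + higherOrderTerms t τ := by
  have h := (hasSum_combinationCoeff (t * τ ^ 2)).tsum_eq
  rw [(hasSum_combinationCoeff (t * τ ^ 2)).summable.tsum_eq_zero_add, combinationCoeff_zero] at h
  rw [hypergeometricTerm, higherOrderTerms, ← h]
  ring

lemma abs_higherOrderTerms_le {t τ : ℝ} (ht : 0 < t) (hτ : 0 < τ) (hx : t * τ ^ 2 ≤ 1) :
    |higherOrderTerms t τ| ≤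
      (∑' k : ℕ, |combinationCoeff (k + 1)|) / (45 * Real.pi) * t ^ 3 * τ ^ 9 := by
  -- Convergence at x = 1 bounds the whole range x ≤ 1, since there x^{k+1} ≤ x.
  have hs : Summable fun k : ℕ => |combinationCoeff (k + 1)| := by
    simpa using (summable_combinationCoeff_succ 1).abs
  set x := t * τ ^ 2 with hxdef
  have hx0 : 0 < x := by positivity
  have hb : |∑' k : ℕ, combinationCoeff (k + 1) * x ^ (k + 1)| ≤
      (∑' k : ℕ, |combinationCoeff (k + 1)|) * x := by
    rw [← tsum_mul_right]
    rw [← Real.norm_eq_abs]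
    refine tsum_of_norm_bounded (hs.mul_right x).hasSum fun k => ?_
    rw [Real.norm_eq_abs, abs_mul, abs_of_pos (pow_pos hx0 _)]
    exact mul_le_mul_of_nonneg_left (pow_le_of_le_one hx0.le hx k.succ_ne_zero) (abs_nonneg _)
  have hpi := Real.pi_pos
  rw [higherOrderTerms, ← hxdef, abs_mul,
    abs_of_nonneg (by positivity : 0 ≤ τ ^ 3 * x ^ 2 / (45 * Real.pi))]
  refine (mul_le_mul_of_nonneg_left hb (by positivity)).trans_eq ?_
  rw [hxdef]
  ring

lemma exists_abs_hypergeometricTerm_sub_le :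
    ∃ C : ℝ, ∀ t τ : ℝ, 0 < t → 0 < τ → 1 ≤ t * τ ^ 2 →
      |hypergeometricTerm t τ -
          τ ^ 3 / Real.pi * (-(Real.sqrt (2 * Real.pi) / 3) * (t * τ ^ 2) ^ (1 / 2 : ℝ)
            + Real.log (4 * t * τ ^ 2) + Real.eulerMascheroniConstant - 3)|
        ≤ C * τ ^ 2 * t ^ (-(1 / 2) : ℝ) := by
  obtain ⟨C, hC⟩ := exists_abs_hypergeometricCombination_sub_le
  refine ⟨C / Real.pi, fun t τ ht hτ hx => ?_⟩
  have hpi := Real.pi_pos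
  have h := mul_le_mul_of_nonneg_left (hC _ hx) (by positivity : 0 ≤ τ ^ 3 / Real.pi)
  rw [← abs_of_nonneg (by positivity : 0 ≤ τ ^ 3 / Real.pi), ← abs_mul,
    abs_of_nonneg (by positivity : 0 ≤ τ ^ 3 / Real.pi), mul_sub] at h
  have e : hypergeometricTerm t τ = τ ^ 3 / Real.pi *
      ((t * τ ^ 2) ^ 2 / 45 * hypergeometricCombination (t * τ ^ 2)) := by
    rw [hypergeometricTerm]
    ring
  rw [e, mul_assoc 4 t]
  refine h.trans_eq ?_
  linear_combination C / Real.pi * cube_mul_rpow_neg_half ht hτ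

/-- An exact identity: the two logarithms combine so that β cancels, the constants give 10/3 - 1/3 =
3, and the 2(tτ²)²/45 term together with R reassembles H. -/
lemma goeCubicTerm_sub_eq {β t τ : ℝ} (hβ : 0 < β) (ht : 0 < t) (hτ : 0 < τ) :
    goeCubicTerm β τ - (wpCubicTerm β t τ - higherOrderTerms t τ) =
      hypergeometricTerm t τ -
        τ ^ 3 / Real.pi * (-(Real.sqrt (2 * Real.pi) / 3) * (t * τ ^ 2) ^ (1 / 2 : ℝ)
          + Real.log (4 * t * τ ^ 2) + Real.eulerMascheroniConstant - 3) := by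
  have hlog : Real.log (4 * t * τ ^ 2) = Real.log (2 * β * τ ^ 2) + Real.log (2 * t / β) := by
    rw [← Real.log_mul (by positivity) (by positivity)]
    congr 1
    field_simp
    ring
  rw [hypergeometricTerm_eq, goeCubicTerm, wpCubicTerm, hlog]
  ring

theorem mainTheorem1 :
    -- the convergent expansion, with leading term of order `τ⁷`
    (∀ t τ : ℝ, 0 < t → 0 < τ →
      Summable (fun k : ℕ => combinationCoeff (k + 1) * (t * τ ^ 2) ^ (k + 1)) ∧
      hypergeometricTerm t τ = 2 * τ ^ 7 * t ^ 2 / (45 * Real.pi) + higherOrderTerms t τ) ∧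
    -- the remaining terms are `O(τ⁹)`
    (∃ C : ℝ, ∀ t τ : ℝ, 0 < t → 0 < τ → t * τ ^ 2 ≤ 1 →
      |higherOrderTerms t τ| ≤ C * t ^ 3 * τ ^ 9) ∧
    -- the large-argument expansion, up to `O(t^{-1/2})`
    (∃ C : ℝ, ∀ t τ : ℝ, 0 < t → 0 < τ → 1 ≤ t * τ ^ 2 →
      |hypergeometricTerm t τ -
          τ ^ 3 / Real.pi * (-(Real.sqrt (2 * Real.pi) / 3) * (t * τ ^ 2) ^ (1 / 2 : ℝ)
            + Real.log (4 * t * τ ^ 2) + Real.eulerMascheroniConstant - 3)|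
        ≤ C * τ ^ 2 * t ^ (-(1 / 2) : ℝ)) ∧
    -- the identity between the cubic terms, up to `O(t^{-1/2})` and the terms of order `τ⁹`
    (∃ C : ℝ, ∀ β t τ : ℝ, 0 < β → 0 < t → 0 < τ → 1 ≤ t * τ ^ 2 →
      |goeCubicTerm β τ - (wpCubicTerm β t τ - higherOrderTerms t τ)|
        ≤ C * τ ^ 2 * t ^ (-(1 / 2) : ℝ)) := by
  obtain ⟨C, hC⟩ := exists_abs_hypergeometricTerm_sub_le
  refine ⟨fun t τ _ _ => ⟨summable_combinationCoeff_succ _, hypergeometricTerm_eq t τ⟩,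
    ⟨_, fun t τ ht hτ hx => abs_higherOrderTerms_le ht hτ hx⟩, ⟨C, hC⟩,
    ⟨C, fun β t τ hβ ht hτ hx => ?_⟩⟩
  rw [goeCubicTerm_sub_eq hβ ht hτ]
  exact hC t τ ht hτ hx
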